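/- Let $S\subset\mathbb{R}^d$ be compact and let $X_1,X_2,\dots$ be i.i.d. random points of $\mathbb{R}^d$ with distribution $P$, where $P$ is a Borel probability measure with (closed) support $S$. Let $B(x,r)$ be the closed Euclidean ball and $\mathbb{P}_n=\frac1n\sum_{i=1}^n\delta_{X_i}$ the empirical measure. The pointwise dimension of $P$ at $x\in S$ is $\dim_{\mathrm{pw}}(x)=\lim_{r\to0^+}\frac{\log P(B(x,r))}{\log r}\in[0,+\infty]$, if this limit exists, and for a sequence $r_n$ its estimator is $\widehat{\dim}_{\mathrm{pw}}(x)=\frac{\log\mathbb{P}_n(B(x,r_n))}{\log r_n}$, with the convention $\log 0=-\infty$. Say that $P$ is standard at $x$ with constants $r_0,\delta,d'>0$ if $P(B(x,r))\ge\delta r^{d'}$ for all $r\in(0,r_0)$. (a) Let $x\in S$ be such that $\dim_{\mathrm{pw}}(x)$ exists and $P$ is standard at $x$ with constants $r_0,\delta,d'$. If $r_n=(C\log n/n)^{1/d'}$ with $C>28/(3\delta)$, then, almost surely, $$\frac{\log\mathbb{P}_n(B(x,r_n))}{\log r_n}\to\dim_{\mathrm{pw}}(x)\quad\text{as } n\to\infty.$$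 (b) Suppose that $P$ is standard at every $x\in S$ with the same constants $r_0,\delta,d'$, that $\dim_{\mathrm{pw}}(x)$ exists for all $x\in S$, and that the convergence defining it is uniform, that is, $\sup_{x\in S}\left|\frac{\log P(B(x,r))}{\log r}-\dim_{\mathrm{pw}}(x)\right|\to0$ as $r\to0^+$. Let $r_n=(\beta\log n/n)^{1/(2d')}$ with $\beta>(4d+12)/\delta^2$. Then, almost surely as $n\to\infty$, $$\sup_{x\in S}\left|\widehat{\dim}_{\mathrm{pw}}(x)-\dim_{\mathrm{pw}}(x)\right|\to0,$$ and consequently, almost surely, $$\sup_{x\in S}\widehat{\dim}_{\mathrm{pw}}(x)\to\sup_{x\in S}\dim_{\mathrm{pw}}(x)\ge\dim_{\mathrm H}(S),\qquad \inf_{x\in S}\widehat{\dim}_{\mathrm{pw}}(x)\to\inf_{x\in S}\dim_{\mathrm{pw}}(x)\le\dim_{\mathrm H}(S),$$ where $\dim_{\mathrm H}(S)$ is the Hausdorff dimension of $S$. -/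

import Mathlib

open MeasureTheory ProbabilityTheory Filter Topology Set

/-- Standardness of `P` at the point `x`, with (positive) constants `r₀`, `δ`, `d'`:
`P (B(x,r)) ≥ δ r ^ d'` for all `r ∈ (0, r₀)`, where `B(x,r)` is the closed ball. -/
def IsStandardAt {d : ℕ} (P : Measure (EuclideanSpace ℝ (Fin d)))
    (x : EuclideanSpace ℝ (Fin d)) (r₀ δ d' : ℝ) : Prop :=
  0 < r₀ ∧ 0 < δ ∧ 0 < d' ∧
    ∀ r ∈ Ioo 0 r₀, ENNReal.ofReal (δ * r ^ d') ≤ P (Metric.closedBall x r)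

/-- The quotient `log (Q (B(x,r))) / log r`, as an extended real number
(with `log 0 = -∞`, so that the quotient is `+∞` if `Q (B(x,r)) = 0` and `0 < r < 1`). -/
noncomputable def logRatio {d : ℕ} (Q : Measure (EuclideanSpace ℝ (Fin d)))
    (x : EuclideanSpace ℝ (Fin d)) (r : ℝ) : EReal :=
  ENNReal.log (Q (Metric.closedBall x r)) / (Real.log r : EReal)

/-- The limit defining the pointwise dimension of `P` at `x` exists (it can be `+∞`). -/
def PointwiseDimExists {d : ℕ} (P : Measure (EuclideanSpace ℝ (Fin d)))
    (x : EuclideanSpace ℝ (Fin d)) : Prop :=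
  ∃ D : EReal, Tendsto (fun r : ℝ => logRatio P x r) (𝓝[>] 0) (𝓝 D)

/-- The pointwise dimension of `P` at `x`: the limit of `log (P (B(x,r))) / log r` as `r → 0+`
(meaningful when `PointwiseDimExists P x` holds). -/
noncomputable def pointwiseDim {d : ℕ} (P : Measure (EuclideanSpace ℝ (Fin d)))
    (x : EuclideanSpace ℝ (Fin d)) : EReal :=
  limUnder (𝓝[>] (0 : ℝ)) (fun r : ℝ => logRatio P x r)

/-- The empirical measure of the first `n` terms of a sequence of points. -/
noncomputable def empiricalMeasure {d : ℕ} (x : ℕ → EuclideanSpace ℝ (Fin d)) (n : ℕ) :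
    Measure (EuclideanSpace ℝ (Fin d)) :=
  (n : ENNReal)⁻¹ • ∑ i ∈ Finset.range n, Measure.dirac (x i)

/-- The plug-in estimator of the pointwise dimension at `x`, for the observed data `X i ω`, `i < n`,
with smoothing parameter `r`. -/
noncomputable def pointwiseDimEstimator {d : ℕ} {Ω : Type*}
    (X : ℕ → Ω → EuclideanSpace ℝ (Fin d)) (ω : Ω) (n : ℕ) (r : ℝ)
    (x : EuclideanSpace ℝ (Fin d)) : EReal :=
  logRatio (empiricalMeasure (fun i => X i ω) n) x r

/-- The smoothing parameter `(C log n / n) ^ (1 / a)`. -/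
noncomputable def smoothingRadius (C a : ℝ) (n : ℕ) : ℝ :=
  (C * (Real.log n / n)) ^ (1 / a)

/-!
Both parts compare the empirical mass of small balls with their true mass up to constant factors
only: since `log r n → -∞`, multiplying a mass by a constant, or the radius by a constant, does not
change the limit of `log (mass) / log r n` (`eventually_abs_localExponent_sub_le`).

The comparison comes from Chernoff's bound: the number of sample points in a set `B` lies between
`n * P B / 4` and `4 * n * P B` outside an event of probability `2 * exp (- n * P B / 4)`
(`measureReal_count_far_from_mean_le`), followed by the Borel-Cantelli lemma
(`ae_eventually_count_near_mean`). At one point this applies to the ball itself, whose mass is at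
least `δ C log n / n` by standardness. For the uniform statement no Vapnik-Chervonenkis theory is
needed: a ball of radius `r` with centre in `S` is squeezed between two balls centred at a point of
an `r / 4`-net of `S`, and standardness bounds the size of such a net by a multiple of `r ^ (-d')`
(`exists_finset_net`), so that a union bound over the net is summable
(`ae_eventually_empiricalMeasure_closedBall_uniform`).

Standardness confines the pointwise dimensions to `[0, d']`, so the uniform convergence can be
stated for real numbers, and suprema and infima converge with it. The comparison with the Hausdorff
dimension is deterministic. Uniformly in `x ∈ S`, the mass of `B(x,r)` lies between `r ^ s` and
`r ^ t` for every `s` above the supremum and every `t` below the infimum of the pointwise dimension.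
The lower bound on the mass gives nets of size `O(r ^ (-s))`
(`dimH_le_of_rpow_le_measureReal`), the upper bound is the hypothesis of the mass distribution
principle (`le_dimH_of_measureReal_le_rpow`).
-/

/-! ### Concentration of counts -/

section Concentration

variable {Ω E : Type*} [MeasurableSpace Ω] [MeasurableSpace E] {μ : Measure Ω}

lemma mgf_indicator_le [IsProbabilityMeasure μ] {Y : Ω → E} (hY : Measurable Y) {B : Set E}
    (hB : MeasurableSet B) (t : ℝ) :
    mgf (fun ω => B.indicator (1 : E → ℝ) (Y ω)) μ t
      ≤ Real.exp ((μ.map Y).real B * (Real.exp t - 1)) := by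
  have hYB : MeasurableSet (Y ⁻¹' B) := hY hB
  have h1 : ∀ ω, Real.exp (t * B.indicator (1 : E → ℝ) (Y ω))
      = 1 + (Y ⁻¹' B).indicator (fun _ => Real.exp t - 1) ω := by
    intro ω
    by_cases h : Y ω ∈ B
    · rw [indicator_of_mem h, indicator_of_mem (show ω ∈ Y ⁻¹' B from h)]; simp
    · rw [indicator_of_notMem h, indicator_of_notMem (show ω ∉ Y ⁻¹' B from h)]; simp
  have h2 : mgf (fun ω => B.indicator (1 : E → ℝ) (Y ω)) μ t
      = 1 + (μ.map Y).real B * (Real.exp t - 1) := by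
    unfold mgf
    simp_rw [h1]
    rw [integral_add (integrable_const _) ((integrable_const _).indicator hYB),
      integral_indicator_const _ hYB, map_measureReal_apply hY hB]
    simp
  rw [h2, add_comm]
  exact Real.add_one_le_exp _

lemma mgf_sum_indicator_le [IsProbabilityMeasure μ] {X : ℕ → Ω → E} (hX : ∀ i, Measurable (X i))
    (hind : iIndepFun X μ) {P : Measure E} (hlaw : ∀ i, μ.map (X i) = P) {B : Set E}
    (hB : MeasurableSet B) (n : ℕ) (t : ℝ) :
    mgf (fun ω => ∑ i ∈ Finset.range n, B.indicator (1 : E → ℝ) (X i ω)) μ t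
      ≤ Real.exp (n * P.real B * (Real.exp t - 1)) := by
  have hmeas : Measurable (B.indicator (1 : E → ℝ)) := measurable_one.indicator hB
  have hI : iIndepFun (fun i ω => B.indicator (1 : E → ℝ) (X i ω)) μ :=
    hind.comp (fun _ => B.indicator (1 : E → ℝ)) (fun _ => hmeas)
  have h := hI.mgf_sum (t := t) (fun i => hmeas.comp (hX i)) (Finset.range n)
  have h' : (fun ω => ∑ i ∈ Finset.range n, B.indicator (1 : E → ℝ) (X i ω))
      = ∑ i ∈ Finset.range n, fun ω => B.indicator (1 : E → ℝ) (X i ω) := by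
    ext ω; simp
  rw [h', h]
  refine (Finset.prod_le_prod (fun i _ => mgf_nonneg)
    (fun i _ => mgf_indicator_le (hX i) hB t)).trans ?_
  simp_rw [hlaw]
  rw [Finset.prod_const, Finset.card_range, ← Real.exp_nat_mul, mul_assoc]

/-- Chernoff's bound: the number of the first `n` points that fall into `B` is within a factor `4`
of its mean `n * P B`, outside an event of probability `2 * exp (- n * P B / 4)`. -/
lemma measureReal_count_far_from_mean_le [IsProbabilityMeasure μ] {X : ℕ → Ω → E}
    (hX : ∀ i, Measurable (X i)) (hind : iIndepFun X μ) {P : Measure E}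
    (hlaw : ∀ i, μ.map (X i) = P) {B : Set E} (hB : MeasurableSet B) (n : ℕ) :
    μ.real ({ω | 4 * (n * P.real B) ≤ ∑ i ∈ Finset.range n, B.indicator (1 : E → ℝ) (X i ω)} ∪
        {ω | ∑ i ∈ Finset.range n, B.indicator (1 : E → ℝ) (X i ω) ≤ n * P.real B / 4})
      ≤ 2 * Real.exp (-(n * P.real B) / 4) := by
  set N : Ω → ℝ := fun ω => ∑ i ∈ Finset.range n, B.indicator (1 : E → ℝ) (X i ω)
  set m : ℝ := n * P.real B
  have hm : 0 ≤ m := by positivity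
  have hmeas : Measurable (B.indicator (1 : E → ℝ)) := measurable_one.indicator hB
  have hNm : Measurable N := Finset.measurable_sum _ fun i _ => hmeas.comp (hX i)
  have hN0 : ∀ ω, 0 ≤ N ω := fun ω =>
    Finset.sum_nonneg fun i _ => indicator_nonneg (fun _ _ => zero_le_one) _
  have hNn : ∀ ω, N ω ≤ n := fun ω => by
    calc N ω ≤ ∑ i ∈ Finset.range n, (1 : ℝ) :=
          Finset.sum_le_sum fun i _ => indicator_le_self' (fun _ _ => zero_le_one) _
      _ = n := by simp
  have hint : ∀ t : ℝ, Integrable (fun ω => Real.exp (t * N ω)) μ := by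
    intro t
    refine Integrable.of_bound (by fun_prop) (Real.exp (|t| * n)) (ae_of_all _ fun ω => ?_)
    rw [Real.norm_eq_abs, Real.abs_exp, Real.exp_le_exp]
    exact mul_le_mul (le_abs_self t) (hNn ω) (hN0 ω) (abs_nonneg t)
  have he := Real.exp_one_lt_d9
  have he' := Real.exp_neg_one_lt_d9
  -- The exponential moments at `t = 1` and `t = -1` give the rates `5 - e` and `3 / 4 - e⁻¹`,
  -- both above `1 / 4`.
  have up : μ.real {ω | 4 * m ≤ N ω} ≤ Real.exp (-m / 4) := by
    refine (measure_ge_le_exp_mul_mgf (4 * m) zero_le_one (hint 1)).trans ?_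
    refine (mul_le_mul_of_nonneg_left (mgf_sum_indicator_le hX hind hlaw hB n 1)
      (Real.exp_pos _).le).trans ?_
    rw [← Real.exp_add, Real.exp_le_exp]
    nlinarith
  have low : μ.real {ω | N ω ≤ m / 4} ≤ Real.exp (-m / 4) := by
    refine (measure_le_le_exp_mul_mgf (m / 4) (by norm_num : (-1 : ℝ) ≤ 0) (hint (-1))).trans ?_
    refine (mul_le_mul_of_nonneg_left (mgf_sum_indicator_le hX hind hlaw hB n (-1))
      (Real.exp_pos _).le).trans ?_
    rw [← Real.exp_add, Real.exp_le_exp]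
    nlinarith
  calc _ ≤ _ := measureReal_union_le _ _
    _ ≤ _ := by linarith

/-- Almost surely, from some `n` on, each of finitely many sets `B y`, `y ∈ T n`, receives a
fraction of the first `n` points that is within a factor `4` of its probability. The families may
change with `n`, as long as the union bound over `T n` is summable. -/
lemma ae_eventually_count_near_mean {ι : Type*} [IsProbabilityMeasure μ] {X : ℕ → Ω → E}
    (hX : ∀ i, Measurable (X i)) (hind : iIndepFun X μ) {P : Measure E}
    (hlaw : ∀ i, μ.map (X i) = P) (T : ℕ → Finset ι) (B : ℕ → ι → Set E)
    (hB : ∀ n y, MeasurableSet (B n y))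
    (hT : ∀ᶠ n : ℕ in atTop, ∀ y ∈ T n,
      (T n).card * Real.exp (-(n * P.real (B n y)) / 4) ≤ 1 / (n : ℝ) ^ 2) :
    ∀ᵐ ω ∂μ, ∀ᶠ n : ℕ in atTop, ∀ y ∈ T n,
      n * P.real (B n y) / 4 ≤ ∑ i ∈ Finset.range n, (B n y).indicator (1 : E → ℝ) (X i ω) ∧
      ∑ i ∈ Finset.range n, (B n y).indicator (1 : E → ℝ) (X i ω) ≤ 4 * (n * P.real (B n y)) := by
  obtain ⟨n₀, hn₀⟩ := eventually_atTop.1 hT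
  set bad : ℕ → ι → Set Ω := fun n y =>
    {ω | 4 * (n * P.real (B n y)) ≤ ∑ i ∈ Finset.range n, (B n y).indicator (1 : E → ℝ) (X i ω)} ∪
      {ω | ∑ i ∈ Finset.range n, (B n y).indicator (1 : E → ℝ) (X i ω) ≤ n * P.real (B n y) / 4}
  set A : ℕ → Set Ω := fun n => {ω | n₀ ≤ n ∧ ω ∈ ⋃ y ∈ T n, bad n y}
  have hA : ∀ n, μ.real (A n) ≤ 2 * (1 / (n : ℝ) ^ 2) := by
    intro n
    by_cases hn : n₀ ≤ n
    · refine (measureReal_mono (s₂ := ⋃ y ∈ T n, bad n y) (fun ω hω => hω.2)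
        (measure_ne_top _ _)).trans
        ((measureReal_biUnion_finset_le (T n) (bad n)).trans ?_)
      rcases (T n).eq_empty_or_nonempty with h0 | hne
      · rw [h0, Finset.sum_empty]; positivity
      have hc : (0 : ℝ) < (T n).card := by exact_mod_cast hne.card_pos
      calc ∑ y ∈ T n, μ.real (bad n y)
          ≤ ∑ y ∈ T n, 2 * (1 / (n : ℝ) ^ 2) / (T n).card := by
            refine Finset.sum_le_sum fun y hy => ?_
            refine (measureReal_count_far_from_mean_le hX hind hlaw (hB n y) n).trans ?_
            rw [le_div_iff₀ hc]
            linarith [hn₀ n hn y hy]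
        _ = 2 * (1 / (n : ℝ) ^ 2) := by
            rw [Finset.sum_const, nsmul_eq_mul]; field_simp
    · have : A n = ∅ := by
        ext ω; simp [A, hn]
      rw [this, measureReal_empty]; positivity
  have hsum : ∑' n, μ (A n) ≠ ⊤ := by
    have hs : Summable fun n : ℕ => 2 * (1 / (n : ℝ) ^ 2) :=
      (Real.summable_one_div_nat_pow.2 one_lt_two).mul_left 2
    refine ne_top_of_le_ne_top hs.tsum_ofReal_ne_top (ENNReal.tsum_le_tsum fun n => ?_)
    rw [← ofReal_measureReal]
    exact ENNReal.ofReal_le_ofReal (hA n)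
  filter_upwards [ae_eventually_notMem hsum] with ω hω
  filter_upwards [hω, eventually_ge_atTop n₀] with n hn hn0 y hy
  have hb : ω ∉ bad n y := fun hb => hn ⟨hn0, mem_biUnion hy hb⟩
  simp only [bad, mem_union, mem_ofPred_eq, not_or, not_le] at hb
  exact ⟨hb.2.le, hb.1.le⟩

end Concentration

/-! ### Nets -/

/-- If all balls of radius `ε / 2` around points of `S` have mass at least `q`, then `S` has an
`ε`-net of at most `1 / q` points: an `ε`-separated set has disjoint balls of radius `ε / 2`. -/
lemma exists_finset_net {E : Type*} [PseudoMetricSpace E] [MeasurableSpace E]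
    [OpensMeasurableSpace E] (P : Measure E) [IsProbabilityMeasure P] {S : Set E} {ε q : ℝ}
    (hε : 0 ≤ ε) (hq : 0 < q) (h : ∀ x ∈ S, q ≤ P.real (Metric.closedBall x (ε / 2))) :
    ∃ T : Finset E, (∀ y ∈ T, y ∈ S) ∧ T.card * q ≤ 1 ∧ ∀ x ∈ S, ∃ y ∈ T, dist x y ≤ ε := by
  classical
  have hcard : ∀ T : Finset E, (∀ y ∈ T, y ∈ S) → (T : Set E).Pairwise (fun x y => ε < dist x y) →
      T.card * q ≤ 1 := by
    intro T hTS hsep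
    calc T.card * q = ∑ y ∈ T, q := by rw [Finset.sum_const, nsmul_eq_mul]
      _ ≤ ∑ y ∈ T, P.real (Metric.closedBall y (ε / 2)) :=
          Finset.sum_le_sum fun y hy => h y (hTS y hy)
      _ = P.real (⋃ y ∈ T, Metric.closedBall y (ε / 2)) := by
          refine (measureReal_biUnion_finset (fun x hx y hy hxy => ?_)
            (fun y _ => Metric.isClosed_closedBall.measurableSet)).symm
          exact Metric.closedBall_disjoint_closedBall (by linarith [hsep hx hy hxy])
      _ ≤ 1 := measureReal_le_one
  by_contra hcon
  push Not at hcon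
  -- Without such a net, separated sets could be enlarged indefinitely.
  have hex : ∀ k : ℕ, ∃ T : Finset E, T.card = k ∧ (∀ y ∈ T, y ∈ S) ∧
      (T : Set E).Pairwise (fun x y => ε < dist x y) := by
    intro k
    induction k with
    | zero => exact ⟨∅, by simp⟩
    | succ k ih =>
      obtain ⟨T, hTk, hTS, hsep⟩ := ih
      obtain ⟨x, hxS, hx⟩ := hcon T hTS (hcard T hTS hsep)
      have hxT : x ∉ T := fun hxT => by
        have := hx x hxT
        rw [dist_self] at this
        linarith
      refine ⟨insert x T, by rw [Finset.card_insert_of_notMem hxT, hTk], ?_, ?_⟩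
      · intro y hy
        rcases Finset.mem_insert.1 hy with rfl | hy
        · exact hxS
        · exact hTS y hy
      · rw [Finset.coe_insert]
        refine hsep.insert fun y hy _ => ⟨hx y hy, ?_⟩
        rw [dist_comm]; exact hx y hy
  obtain ⟨k, hk⟩ := exists_nat_gt (1 / q)
  obtain ⟨T, hTk, hTS, hsep⟩ := hex k
  have := hcard T hTS hsep
  rw [hTk] at this
  rw [div_lt_iff₀ hq] at hk
  linarith

/-! ### Local exponents -/

/-- The real-valued quotient `log (Q (B(x,r))) / log r`. It agrees with `logRatio` when the ball
has positive finite mass, and is only used in that case. -/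
noncomputable def localExponent {E : Type*} [PseudoMetricSpace E] [MeasurableSpace E]
    (Q : Measure E) (x : E) (r : ℝ) : ℝ :=
  Real.log (Q.real (Metric.closedBall x r)) / Real.log r

/-- Replacing a mass by one that is comparable to the masses at the radii `r / 4` and `4 * r`
changes the exponent at scale `r` by `O(1 / |log r|)` only. -/
lemma abs_log_div_log_sub_le {r p₁ p₂ q D M ε : ℝ} (hr : 0 < r) (hr' : 4 * r < 1) (hp₁ : 0 < p₁)
    (h₁ : p₁ / 4 ≤ q) (h₂ : q ≤ 4 * p₂) (hDM : D ≤ M) (hε : 0 ≤ ε) (hε' : ε ≤ 1)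
    (H₁ : |Real.log p₁ / Real.log (r / 4) - D| ≤ ε)
    (H₂ : |Real.log p₂ / Real.log (4 * r) - D| ≤ ε) :
    |Real.log q / Real.log r - D| ≤ ε + (M + 2) * (Real.log 4 / -Real.log r) := by
  have hq : 0 < q := by linarith
  have hp₂ : 0 < p₂ := by linarith
  have hk : 0 < Real.log 4 := Real.log_pos (by norm_num)
  have e₁ : Real.log (r / 4) = Real.log r - Real.log 4 := Real.log_div hr.ne' (by norm_num)
  have e₂ : Real.log (4 * r) = Real.log 4 + Real.log r := Real.log_mul (by norm_num) hr.ne'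
  have hl : Real.log 4 + Real.log r < 0 := e₂ ▸ Real.log_neg (by linarith) hr'
  have g₁ : Real.log p₁ - Real.log 4 ≤ Real.log q := by
    rw [← Real.log_div hp₁.ne' (by norm_num)]
    exact Real.log_le_log (by linarith) h₁
  have g₂ : Real.log q ≤ Real.log 4 + Real.log p₂ := by
    rw [← Real.log_mul (by norm_num) hp₂.ne']
    exact Real.log_le_log hq h₂
  rw [e₁] at H₁
  rw [e₂] at H₂
  generalize Real.log 4 = k at *
  generalize Real.log r = l at *
  generalize Real.log p₁ = a at *
  generalize Real.log p₂ = b at *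
  generalize Real.log q = c at *
  have hl0 : l < 0 := by linarith
  have H₁' := (abs_le.1 H₁).2
  have H₂' := (abs_le.1 H₂).1
  have a₁ : (D + ε) * (l - k) ≤ a := by
    have : a / (l - k) ≤ D + ε := by linarith
    rwa [div_le_iff_of_neg (by linarith)] at this
  have a₂ : b ≤ (D - ε) * (k + l) := by
    have : D - ε ≤ b / (k + l) := by linarith
    rwa [le_div_iff_of_neg (by linarith)] at this
  have hl' : (M + 2) * (k / -l) * l = -((M + 2) * k) := by
    have := hl0.ne
    field_simp
  rw [abs_le]
  constructor
  · have : D - ε - (M + 2) * (k / -l) ≤ c / l := by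
      rw [le_div_iff_of_neg hl0, sub_mul, hl']
      nlinarith
    linarith
  · have : c / l ≤ D + ε + (M + 2) * (k / -l) := by
      rw [div_le_iff_of_neg hl0, add_mul, hl']
      nlinarith
    linarith

lemma localExponent_le_iff {E : Type*} [PseudoMetricSpace E] [MeasurableSpace E] {Q : Measure E}
    {x : E} {r s : ℝ} (h0 : 0 < r) (h1 : r < 1) (hQ : 0 < Q.real (Metric.closedBall x r)) :
    localExponent Q x r ≤ s ↔ r ^ s ≤ Q.real (Metric.closedBall x r) := by
  rw [localExponent, div_le_iff_of_neg (Real.log_neg h0 h1), ← Real.log_rpow h0,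
    Real.log_le_log_iff (Real.rpow_pos_of_pos h0 s) hQ]

lemma le_localExponent_iff {E : Type*} [PseudoMetricSpace E] [MeasurableSpace E] {Q : Measure E}
    {x : E} {r s : ℝ} (h0 : 0 < r) (h1 : r < 1) (hQ : 0 < Q.real (Metric.closedBall x r)) :
    s ≤ localExponent Q x r ↔ Q.real (Metric.closedBall x r) ≤ r ^ s := by
  rw [localExponent, le_div_iff_of_neg (Real.log_neg h0 h1), ← Real.log_rpow h0,
    Real.log_le_log_iff hQ (Real.rpow_pos_of_pos h0 s)]

section LocalExponent

variable {E : Type*} [PseudoMetricSpace E] [MeasurableSpace E] {P : Measure E} {A : Set E}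
  {D : E → ℝ}

/-- If the measures `Q n` are comparable to `P` on balls, up to constant factors in mass and radius,
then their exponents at scales `r n → 0` converge to those of `P`, uniformly on `A`. -/
lemma eventually_abs_localExponent_sub_le {M : ℝ} (hD : ∀ x ∈ A, D x ≤ M)
    (Q : ℕ → Measure E) {r : ℕ → ℝ} (hr : Tendsto r atTop (𝓝[>] 0))
    (hpos : ∀ᶠ s in 𝓝[>] (0 : ℝ), ∀ x ∈ A, 0 < P.real (Metric.closedBall x s))
    (hP : ∀ ε > 0, ∀ᶠ s in 𝓝[>] (0 : ℝ), ∀ x ∈ A, |localExponent P x s - D x| ≤ ε)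
    (hQ : ∀ᶠ n in atTop, ∀ x ∈ A,
      P.real (Metric.closedBall x (r n / 4)) / 4 ≤ (Q n).real (Metric.closedBall x (r n)) ∧
      (Q n).real (Metric.closedBall x (r n)) ≤ 4 * P.real (Metric.closedBall x (4 * r n)))
    {ε : ℝ} (hε : 0 < ε) :
    ∀ᶠ n in atTop, ∀ x ∈ A, 0 < (Q n).real (Metric.closedBall x (r n)) ∧
      |localExponent (Q n) x (r n) - D x| ≤ ε := by
  obtain ⟨hr0, hrpos⟩ := tendsto_nhdsWithin_iff.1 hr
  have hr1 : Tendsto (fun n => r n / 4) atTop (𝓝[>] 0) := by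
    refine tendsto_nhdsWithin_iff.2 ⟨by simpa using hr0.div_const 4, ?_⟩
    filter_upwards [hrpos] with n hn
    exact mem_Ioi.2 (div_pos (mem_Ioi.1 hn) four_pos)
  have hr2 : Tendsto (fun n => 4 * r n) atTop (𝓝[>] 0) := by
    refine tendsto_nhdsWithin_iff.2 ⟨by simpa using hr0.const_mul 4, ?_⟩
    filter_upwards [hrpos] with n hn
    exact mem_Ioi.2 (mul_pos four_pos (mem_Ioi.1 hn))
  set δ := min (ε / 2) 1
  have hδ : 0 < δ := lt_min (by linarith) one_pos
  have herr : Tendsto (fun n => (M + 2) * (Real.log 4 / -Real.log (r n))) atTop (𝓝 0) := by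
    have := (tendsto_neg_atBot_atTop.comp (Real.tendsto_log_nhdsGT_zero.comp hr)).const_div_atTop
      (Real.log 4)
    simpa using this.const_mul (M + 2)
  filter_upwards [hQ, hrpos, hr1.eventually (hP δ hδ), hr2.eventually (hP δ hδ),
    hr1.eventually hpos, herr.eventually_le_const (half_pos hε),
    (tendsto_nhdsWithin_iff.1 hr2).1.eventually_lt_const one_pos]
    with n h1 h2 h3 h4 h5 h6 h7 x hx
  have hp := h5 x hx
  refine ⟨by linarith [(h1 x hx).1], ?_⟩
  refine (abs_log_div_log_sub_le h2 h7 hp (h1 x hx).1 (h1 x hx).2 (hD x hx) hδ.le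
    (min_le_right _ _) (h3 x hx) (h4 x hx)).trans ?_
  linarith [min_le_left (ε / 2) 1]

end LocalExponent

/-! ### Hausdorff dimension and the mass of small balls -/

section Hausdorff

variable {E : Type*} [MetricSpace E] [MeasurableSpace E] [BorelSpace E] {P : Measure E}
  [IsProbabilityMeasure P] {S : Set E}

/-- Sets on which small balls have mass at least `r ^ s` have nets of at most `(ε / 2) ^ (-s)`
points, so their dimension is at most `s`. -/
lemma dimH_le_of_rpow_le_measureReal {s : ℝ} (hs : 0 ≤ s)
    (h : ∀ᶠ r in 𝓝[>] (0 : ℝ), ∀ x ∈ S, r ^ s ≤ P.real (Metric.closedBall x r)) :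
    dimH S ≤ ENNReal.ofReal s := by
  have hnet : ∀ ε : ℝ, ∃ T : Finset E, 0 < ε →
      (∀ x ∈ S, (ε / 2) ^ s ≤ P.real (Metric.closedBall x (ε / 2))) →
      T.card * (ε / 2) ^ s ≤ 1 ∧ ∀ x ∈ S, ∃ y ∈ T, dist x y ≤ ε := by
    intro ε
    by_cases hε : 0 < ε ∧ ∀ x ∈ S, (ε / 2) ^ s ≤ P.real (Metric.closedBall x (ε / 2))
    · obtain ⟨T, -, hT⟩ := exists_finset_net P hε.1.le
        (Real.rpow_pos_of_pos (half_pos hε.1) s) hε.2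
      exact ⟨T, fun _ _ => hT⟩
    · exact ⟨∅, fun h1 h2 => (hε ⟨h1, h2⟩).elim⟩
  choose T hT using hnet
  have hhalf : Tendsto (fun ε : ℝ => ε / 2) (𝓝[>] 0) (𝓝[>] 0) := by
    refine tendsto_nhdsWithin_iff.2 ⟨?_, ?_⟩
    · exact ((continuous_id.div_const (2 : ℝ)).tendsto' 0 0 (by simp)).mono_left nhdsWithin_le_nhds
    · filter_upwards [self_mem_nhdsWithin] with ε hε
      exact mem_Ioi.2 (half_pos (mem_Ioi.1 hε))
  have hgood : ∀ᶠ ε in 𝓝[>] (0 : ℝ), 0 < ε ∧ (T ε).card * (ε / 2) ^ s ≤ 1 ∧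
      ∀ x ∈ S, ∃ y ∈ T ε, dist x y ≤ ε := by
    filter_upwards [hhalf.eventually h, self_mem_nhdsWithin] with ε h1 h2
    exact ⟨h2, hT ε h2 h1⟩
  have hdiam : ∀ (ε : ℝ) (y : E), 0 < ε →
      Metric.ediam (Metric.closedBall y ε) ≤ ENNReal.ofReal (2 * ε) := by
    intro ε y hε
    rw [← Metric.closedEBall_ofReal hε.le, ENNReal.ofReal_mul zero_le_two]
    simpa using Metric.ediam_closedEBall_le
  have key := Measure.hausdorffMeasure_le_liminf_sum (l := 𝓝[>] (0 : ℝ)) (ι := fun ε => T ε) s S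
    (fun ε => ENNReal.ofReal (2 * ε))
    (by
      have : Tendsto (fun ε : ℝ => ENNReal.ofReal (2 * ε)) (𝓝 0) (𝓝 0) := by
        have hc : Continuous fun ε : ℝ => ENNReal.ofReal (2 * ε) :=
          ENNReal.continuous_ofReal.comp (continuous_const_mul 2)
        exact hc.tendsto' 0 0 (by simp)
      exact this.mono_left nhdsWithin_le_nhds)
    (fun ε y => Metric.closedBall (y : E) ε)
    (by
      filter_upwards [hgood] with ε hε y
      exact hdiam ε y hε.1)
    (by
      filter_upwards [hgood] with ε hε x hx
      obtain ⟨y, hy, hxy⟩ := hε.2.2 x hx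
      exact mem_iUnion.2 ⟨⟨y, hy⟩, hxy⟩)
  have hle : liminf (fun ε : ℝ => ∑ y : T ε, Metric.ediam (Metric.closedBall (y : E) ε) ^ s)
      (𝓝[>] (0 : ℝ)) ≤ ENNReal.ofReal (4 ^ s) := by
    refine (liminf_le_liminf (v := fun _ => ENNReal.ofReal (4 ^ s)) ?_).trans
      (by rw [liminf_const])
    filter_upwards [hgood] with ε hε
    have h4 : (2 * ε) ^ s = 4 ^ s * (ε / 2) ^ s := by
      rw [← Real.mul_rpow (by norm_num) (by linarith [hε.1])]
      congr 1; ring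
    calc ∑ y : T ε, Metric.ediam (Metric.closedBall (y : E) ε) ^ s
        ≤ ∑ y : T ε, ENNReal.ofReal ((2 * ε) ^ s) := by
          refine Finset.sum_le_sum fun y _ => ?_
          rw [← ENNReal.ofReal_rpow_of_nonneg (by linarith [hε.1]) hs]
          exact ENNReal.rpow_le_rpow (hdiam ε y hε.1) hs
      _ = ENNReal.ofReal ((T ε).card * (2 * ε) ^ s) := by
          rw [Finset.sum_const, Finset.card_univ, Fintype.card_coe, nsmul_eq_mul,
            ENNReal.ofReal_mul (by positivity), ENNReal.ofReal_natCast]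
      _ ≤ ENNReal.ofReal (4 ^ s) := by
          refine ENNReal.ofReal_le_ofReal ?_
          rw [h4]
          have : (0 : ℝ) < 4 ^ s := by positivity
          nlinarith [hε.2.1]
  have hfin : μH[s] S ≠ ⊤ := ne_top_of_le_ne_top ENNReal.ofReal_ne_top (key.trans hle)
  lift s to NNReal using hs
  simpa using dimH_le_of_hausdorffMeasure_ne_top hfin

/-- The mass distribution principle. -/
lemma le_dimH_of_measureReal_le_rpow {s : ℝ} (hs : 0 < s) (hS : P Sᶜ = 0)
    (h : ∀ᶠ r in 𝓝[>] (0 : ℝ), ∀ x ∈ S, P.real (Metric.closedBall x r) ≤ r ^ s) :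
    ENNReal.ofReal s ≤ dimH S := by
  obtain ⟨ε, hε, hball⟩ := mem_nhdsGT_iff_exists_Ioo_subset.1 h
  have hε0 : 0 < ε := hε
  have key : P ≤ μH[s] := by
    refine Measure.le_hausdorffMeasure s P (ENNReal.ofReal (ε / 2)) (by simpa using hε0) ?_
    intro U hU
    rcases (U ∩ S).eq_empty_or_nonempty with hUS | ⟨x, hxU, hxS⟩
    · rw [measure_mono_null (fun y hy hyS => ?_) hS]
      · exact zero_le
      · exact (hUS ▸ (⟨hy, hyS⟩ : y ∈ U ∩ S) : y ∈ (∅ : Set E))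
    have hfin : Metric.ediam U ≠ ⊤ := ne_top_of_le_ne_top ENNReal.ofReal_ne_top hU
    set ρ := (Metric.ediam U).toReal
    have hρε : ρ < ε := by
      have := ENNReal.toReal_le_of_le_ofReal (by linarith) hU
      linarith
    have hρ0 : 0 ≤ ρ := ENNReal.toReal_nonneg
    have hUρ : ENNReal.ofReal ρ = Metric.ediam U := ENNReal.ofReal_toReal hfin
    -- Radii slightly above the diameter also serve sets of diameter zero.
    have hlim : Tendsto (fun r : ℝ => ENNReal.ofReal (r ^ s)) (𝓝[>] ρ)
        (𝓝 (ENNReal.ofReal (ρ ^ s))) :=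
      ((ENNReal.continuous_ofReal.comp (Real.continuous_rpow_const hs.le)).tendsto ρ).mono_left
        nhdsWithin_le_nhds
    rw [← hUρ, ENNReal.ofReal_rpow_of_nonneg hρ0 hs.le]
    refine ge_of_tendsto hlim ?_
    filter_upwards [Ioo_mem_nhdsGT hρε] with r hr
    have hsub : U ⊆ Metric.closedBall x r := by
      intro y hy
      have h1 : edist y x ≤ ENNReal.ofReal ρ := hUρ ▸ Metric.edist_le_ediam_of_mem hy hxU
      rw [edist_dist, ENNReal.ofReal_le_ofReal_iff hρ0] at h1
      exact h1.trans hr.1.le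
    refine (measure_mono hsub).trans ?_
    rw [← ofReal_measureReal]
    exact ENNReal.ofReal_le_ofReal (hball ⟨hρ0.trans_lt hr.1, hr.2⟩ x hxS)
  have hne : μH[s] S ≠ 0 := by
    intro h0
    have hPS : P S = 0 := nonpos_iff_eq_zero.1 (h0 ▸ key S)
    have : P univ = 0 := by
      rw [← union_compl_self S]; exact measure_union_null hPS hS
    simp at this
  lift s to NNReal using hs.le
  simpa using le_dimH_of_hausdorffMeasure_ne_zero hne

variable {D : E → ℝ}

/-- Where the local exponents converge uniformly, an upper bound of their limits bounds the
dimension from above. -/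
lemma dimH_le_of_localExponent {M : ℝ} (hM : 0 ≤ M) (hDM : ∀ x ∈ S, D x ≤ M)
    (hpos : ∀ᶠ s in 𝓝[>] (0 : ℝ), ∀ x ∈ S, 0 < P.real (Metric.closedBall x s))
    (hP : ∀ ε > 0, ∀ᶠ s in 𝓝[>] (0 : ℝ), ∀ x ∈ S, |localExponent P x s - D x| ≤ ε) :
    dimH S ≤ ENNReal.ofReal M := by
  have h : ∀ ε : ℝ, 0 < ε → dimH S ≤ ENNReal.ofReal (M + ε) := by
    intro ε hε
    refine dimH_le_of_rpow_le_measureReal (P := P) (by linarith) ?_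
    filter_upwards [hpos, hP ε hε, Ioo_mem_nhdsGT one_pos] with r h1 h2 h3 x hx
    rw [← localExponent_le_iff h3.1 h3.2 (h1 x hx)]
    linarith [(abs_le.1 (h2 x hx)).2, hDM x hx]
  have hlim : Tendsto (fun ε : ℝ => ENNReal.ofReal (M + ε)) (𝓝[>] 0) (𝓝 (ENNReal.ofReal M)) := by
    have hc : Continuous fun ε : ℝ => ENNReal.ofReal (M + ε) :=
      ENNReal.continuous_ofReal.comp (continuous_const_add M)
    exact (hc.tendsto' 0 _ (by simp)).mono_left nhdsWithin_le_nhds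
  refine ge_of_tendsto hlim ?_
  filter_upwards [self_mem_nhdsWithin] with ε hε using h ε hε

/-- On a carrier of `P` where the local exponents converge uniformly, a lower bound of their limits
bounds the dimension from below. -/
lemma le_dimH_of_localExponent {m : ℝ} (hDm : ∀ x ∈ S, m ≤ D x) (hS : P Sᶜ = 0)
    (hpos : ∀ᶠ s in 𝓝[>] (0 : ℝ), ∀ x ∈ S, 0 < P.real (Metric.closedBall x s))
    (hP : ∀ ε > 0, ∀ᶠ s in 𝓝[>] (0 : ℝ), ∀ x ∈ S, |localExponent P x s - D x| ≤ ε) :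
    ENNReal.ofReal m ≤ dimH S := by
  rcases le_or_gt m 0 with hm | hm
  · rw [ENNReal.ofReal_of_nonpos hm]; exact zero_le
  have h : ∀ s : ℝ, 0 < s → s < m → ENNReal.ofReal s ≤ dimH S := by
    intro s hs hsm
    refine le_dimH_of_measureReal_le_rpow (P := P) hs hS ?_
    filter_upwards [hpos, hP (m - s) (by linarith), Ioo_mem_nhdsGT one_pos] with r h1 h2 h3 x hx
    rw [← le_localExponent_iff h3.1 h3.2 (h1 x hx)]
    linarith [(abs_le.1 (h2 x hx)).1, hDm x hx]
  refine le_of_tendsto ((ENNReal.continuous_ofReal.tendsto m).mono_left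
    (nhdsWithin_le_nhds (s := Iio m))) ?_
  filter_upwards [Ioo_mem_nhdsLT hm] with s hs using h s hs.1 hs.2

end Hausdorff

/-! ### The empirical measure -/

lemma measureReal_closedBall_mono {E : Type*} [PseudoMetricSpace E] [MeasurableSpace E]
    {Q : Measure E} [IsFiniteMeasure Q] {x y : E} {r s : ℝ} (h : r + dist x y ≤ s) :
    Q.real (Metric.closedBall x r) ≤ Q.real (Metric.closedBall y s) :=
  measureReal_mono (Metric.closedBall_subset_closedBall' h) (measure_ne_top _ _)

section Empirical

variable {d : ℕ}

instance isFiniteMeasure_empiricalMeasure (x : ℕ → EuclideanSpace ℝ (Fin d)) (n : ℕ) :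
    IsFiniteMeasure (empiricalMeasure x n) := by
  refine ⟨?_⟩
  rcases Nat.eq_zero_or_pos n with rfl | hn
  · simp [empiricalMeasure]
  · have hn' : (n : ENNReal) ≠ 0 := by exact_mod_cast hn.ne'
    simp [empiricalMeasure, ENNReal.inv_mul_cancel hn' (ENNReal.natCast_ne_top n)]

lemma empiricalMeasure_real_apply (x : ℕ → EuclideanSpace ℝ (Fin d)) (n : ℕ)
    {B : Set (EuclideanSpace ℝ (Fin d))} (hB : MeasurableSet B) :
    (empiricalMeasure x n).real B
      = (n : ℝ)⁻¹ * ∑ i ∈ Finset.range n, B.indicator (1 : EuclideanSpace ℝ (Fin d) → ℝ) (x i) := by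
  rw [empiricalMeasure, measureReal_ennreal_smul_apply, ENNReal.toReal_inv, ENNReal.toReal_natCast,
    measureReal_def, Measure.finsetSum_apply, ENNReal.toReal_sum (fun i _ => measure_ne_top _ _)]
  congr 1
  refine Finset.sum_congr rfl fun i _ => ?_
  rw [Measure.dirac_apply' _ hB]
  by_cases h : x i ∈ B <;> simp [h]

variable {Ω : Type*} [MeasurableSpace Ω] {μ : Measure Ω} [IsProbabilityMeasure μ]
  {P : Measure (EuclideanSpace ℝ (Fin d))} {X : ℕ → Ω → EuclideanSpace ℝ (Fin d)}

lemma ae_eventually_empiricalMeasure_closedBall (hX : ∀ i, Measurable (X i))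
    (hind : iIndepFun X μ) (hlaw : ∀ i, μ.map (X i) = P)
    (T : ℕ → Finset (EuclideanSpace ℝ (Fin d))) (ρ : ℕ → ℝ)
    (hT : ∀ᶠ n : ℕ in atTop, ∀ y ∈ T n,
      (T n).card * Real.exp (-(n * P.real (Metric.closedBall y (ρ n))) / 4) ≤ 1 / (n : ℝ) ^ 2) :
    ∀ᵐ ω ∂μ, ∀ᶠ n : ℕ in atTop, ∀ y ∈ T n,
      P.real (Metric.closedBall y (ρ n)) / 4
        ≤ (empiricalMeasure (fun i => X i ω) n).real (Metric.closedBall y (ρ n)) ∧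
      (empiricalMeasure (fun i => X i ω) n).real (Metric.closedBall y (ρ n))
        ≤ 4 * P.real (Metric.closedBall y (ρ n)) := by
  have hB : ∀ (n : ℕ) (y : EuclideanSpace ℝ (Fin d)), MeasurableSet (Metric.closedBall y (ρ n)) :=
    fun n y => Metric.isClosed_closedBall.measurableSet
  filter_upwards [ae_eventually_count_near_mean hX hind hlaw T
    (fun n y => Metric.closedBall y (ρ n)) hB hT] with ω hω
  filter_upwards [hω, eventually_gt_atTop 0] with n hn hn0 y hy
  have hn' : (0 : ℝ) < n := by exact_mod_cast hn0
  obtain ⟨h1, h2⟩ := hn y hy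
  rw [empiricalMeasure_real_apply _ _ (hB n y), inv_mul_eq_div, le_div_iff₀ hn', div_le_iff₀ hn']
  exact ⟨by linarith, by linarith⟩

/-- Comparison of the empirical measure with `P`, simultaneously on all balls with centre in `S`,
when balls of radius `r n / 8` have mass at least `q n`: every ball of radius `r n` is squeezed
between balls of radii `r n / 2` and `2 * r n` around a point of an `r n / 4`-net of size at most
`1 / q n`. -/
lemma ae_eventually_empiricalMeasure_closedBall_uniform [IsProbabilityMeasure P]
    (hX : ∀ i, Measurable (X i))
    (hind : iIndepFun X μ) (hlaw : ∀ i, μ.map (X i) = P) {S : Set (EuclideanSpace ℝ (Fin d))}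
    {r q : ℕ → ℝ} (hr : ∀ᶠ n in atTop, 0 < r n) (hq : ∀ᶠ n in atTop, 0 < q n)
    (hP : ∀ᶠ n in atTop, ∀ x ∈ S, q n ≤ P.real (Metric.closedBall x (r n / 8)))
    (hsum : ∀ᶠ n : ℕ in atTop, 1 / q n * Real.exp (-(n * q n) / 4) ≤ 1 / (n : ℝ) ^ 2) :
    ∀ᵐ ω ∂μ, ∀ᶠ n : ℕ in atTop, ∀ x ∈ S,
      P.real (Metric.closedBall x (r n / 4)) / 4
        ≤ (empiricalMeasure (fun i => X i ω) n).real (Metric.closedBall x (r n)) ∧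
      (empiricalMeasure (fun i => X i ω) n).real (Metric.closedBall x (r n))
        ≤ 4 * P.real (Metric.closedBall x (4 * r n)) := by
  have hnet : ∀ n, ∃ T : Finset (EuclideanSpace ℝ (Fin d)), 0 < r n → 0 < q n →
      (∀ x ∈ S, q n ≤ P.real (Metric.closedBall x (r n / 8))) →
      (∀ y ∈ T, y ∈ S) ∧ T.card * q n ≤ 1 ∧ ∀ x ∈ S, ∃ y ∈ T, dist x y ≤ r n / 4 := by
    intro n
    by_cases h : 0 < r n ∧ 0 < q n ∧ ∀ x ∈ S, q n ≤ P.real (Metric.closedBall x (r n / 8))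
    · obtain ⟨T, hT⟩ := exists_finset_net P (S := S) (ε := r n / 4) (by linarith) h.2.1
        (fun x hx => by
          have : r n / 4 / 2 = r n / 8 := by ring
          rw [this]; exact h.2.2 x hx)
      exact ⟨T, fun _ _ _ => hT⟩
    · exact ⟨∅, fun h1 h2 h3 => (h ⟨h1, h2, h3⟩).elim⟩
  choose T hT using hnet
  have hunion : ∀ c : ℝ, 1 / 8 ≤ c → ∀ᶠ n : ℕ in atTop, ∀ y ∈ T n,
      (T n).card * Real.exp (-(n * P.real (Metric.closedBall y (c * r n))) / 4)
        ≤ 1 / (n : ℝ) ^ 2 := by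
    intro c hc
    filter_upwards [hr, hq, hP, hsum] with n h1 h2 h3 h4 y hy
    obtain ⟨hTS, hcard, -⟩ := hT n h1 h2 h3
    refine le_trans ?_ h4
    have h5 : q n ≤ P.real (Metric.closedBall y (c * r n)) :=
      (h3 y (hTS y hy)).trans (measureReal_mono (Metric.closedBall_subset_closedBall (by nlinarith)))
    refine mul_le_mul ((le_div_iff₀ h2).2 hcard) (Real.exp_le_exp.2 ?_) (Real.exp_pos _).le
      (by positivity)
    have := mul_le_mul_of_nonneg_left h5 (Nat.cast_nonneg (α := ℝ) n)
    linarith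
  filter_upwards [ae_eventually_empiricalMeasure_closedBall hX hind hlaw T _
      (hunion (1 / 2) (by norm_num)),
    ae_eventually_empiricalMeasure_closedBall hX hind hlaw T _ (hunion 2 (by norm_num))]
    with ω hω₁ hω₂
  filter_upwards [hω₁, hω₂, hr, hq, hP] with n hn₁ hn₂ h1 h2 h3 x hx
  obtain ⟨y, hyT, hxy⟩ := (hT n h1 h2 h3).2.2 x hx
  have hyx : dist y x ≤ r n / 4 := by rwa [dist_comm]
  set Q := empiricalMeasure (fun i => X i ω) n
  have i₁ := measureReal_closedBall_mono (Q := P) (x := x) (y := y) (r := r n / 4)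
    (s := 1 / 2 * r n) (by linarith)
  have i₂ := measureReal_closedBall_mono (Q := Q) (x := y) (y := x) (r := 1 / 2 * r n)
    (s := r n) (by linarith)
  have i₃ := measureReal_closedBall_mono (Q := Q) (x := x) (y := y) (r := r n)
    (s := 2 * r n) (by linarith)
  have i₄ := measureReal_closedBall_mono (Q := P) (x := y) (y := x) (r := 2 * r n)
    (s := 4 * r n) (by linarith)
  exact ⟨by linarith [(hn₁ y hyT).1], by linarith [(hn₂ y hyT).2]⟩

end Empirical

/-! ### The smoothing radius -/

lemma eventually_smoothingRadius_pos {C a : ℝ} (hC : 0 < C) :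
    ∀ᶠ n in atTop, 0 < smoothingRadius C a n := by
  filter_upwards [eventually_ge_atTop 2] with n hn
  have hn' : (1 : ℝ) < n := by exact_mod_cast hn
  have := Real.log_pos hn'
  exact Real.rpow_pos_of_pos (by positivity) _

lemma tendsto_smoothingRadius {C a : ℝ} (hC : 0 < C) (ha : 0 < a) :
    Tendsto (smoothingRadius C a) atTop (𝓝[>] 0) := by
  refine tendsto_nhdsWithin_iff.2 ⟨?_, eventually_smoothingRadius_pos hC⟩
  have h1 : Tendsto (fun n : ℕ => C * (Real.log n / n)) atTop (𝓝 0) := by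
    have := (Real.isLittleO_log_id_atTop.tendsto_div_nhds_zero).comp
      (tendsto_natCast_atTop_atTop (R := ℝ))
    simpa using this.const_mul C
  have h2 := h1.rpow_const (p := 1 / a) (Or.inr (by positivity))
  rwa [Real.zero_rpow (by positivity)] at h2

lemma smoothingRadius_rpow {C a : ℝ} (hC : 0 < C) (ha : 0 < a) (n : ℕ) :
    smoothingRadius C a n ^ a = C * (Real.log n / n) := by
  have h : 0 ≤ C * (Real.log n / n) :=
    mul_nonneg hC.le (div_nonneg (Real.log_natCast_nonneg n) (Nat.cast_nonneg n))
  rw [smoothingRadius, ← Real.rpow_mul h, one_div_mul_cancel ha.ne', Real.rpow_one]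

lemma exp_neg_mul_log_natCast {n k : ℕ} (hn : 0 < n) :
    Real.exp (-(k * Real.log n)) = 1 / (n : ℝ) ^ k := by
  have hn' : (0 : ℝ) < n := by exact_mod_cast hn
  rw [Real.exp_neg, mul_comm, Real.exp_mul, Real.exp_log hn', Real.rpow_natCast, one_div]

/-- The radius `r n = (β log n / n) ^ (1 / (2 d'))` makes `q n = c * r n ^ d'` of order
`(log n / n) ^ (1 / 2)`, so that `n * q n` dominates any multiple of `log n`. -/
lemma eventually_union_bound_smoothingRadius {c β d' : ℝ} (hc : 0 < c) (hβ : 0 < β)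
    (hd : 0 < d') :
    ∀ᶠ n : ℕ in atTop, 1 / (c * smoothingRadius β (2 * d') n ^ d') *
      Real.exp (-(n * (c * smoothingRadius β (2 * d') n ^ d')) / 4) ≤ 1 / (n : ℝ) ^ 2 := by
  have h2d : 0 < 2 * d' := by linarith
  have hlim : Tendsto (fun n => c * smoothingRadius β (2 * d') n ^ d') atTop (𝓝 0) := by
    have h := (tendsto_nhdsWithin_iff.1 (tendsto_smoothingRadius hβ h2d)).1.rpow_const (p := d')
      (Or.inr hd.le)
    rw [Real.zero_rpow hd.ne'] at h
    simpa using h.const_mul c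
  filter_upwards [hlim.eventually_le_const (show 0 < c ^ 2 * β / 12 by positivity),
    eventually_smoothingRadius_pos (a := 2 * d') hβ, eventually_ge_atTop 3] with n h1 h2 h3
  have hn : (0 : ℝ) < n := by exact_mod_cast (by omega : 0 < n)
  have hsq : (smoothingRadius β (2 * d') n ^ d') ^ 2 = β * (Real.log n / n) := by
    rw [← smoothingRadius_rpow hβ h2d n, ← Real.rpow_natCast, ← Real.rpow_mul h2.le]
    congr 1; push_cast; ring
  have hq : 0 < c * smoothingRadius β (2 * d') n ^ d' :=
    mul_pos hc (Real.rpow_pos_of_pos h2 _)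
  have hnq : n * (c * smoothingRadius β (2 * d') n ^ d') ^ 2 = c ^ 2 * β * Real.log n := by
    rw [mul_pow, hsq]; field_simp
  generalize c * smoothingRadius β (2 * d') n ^ d' = q at *
  have hlog : 1 ≤ Real.log n := by
    rw [Real.le_log_iff_exp_le hn]
    have : (3 : ℝ) ≤ n := by exact_mod_cast h3
    linarith [Real.exp_one_lt_d9]
  -- As `n * q ^ 2 = c ^ 2 * β * log n` and `q → 0`, eventually `n * q ≥ 12 * log n`.
  have hge : 12 * Real.log n ≤ n * q := by
    have h4 : q * (12 * Real.log n) ≤ q * (n * q) := by nlinarith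
    exact le_of_mul_le_mul_left h4 hq
  have hinv : 1 / q ≤ n := by
    rw [div_le_iff₀ hq]; linarith
  calc 1 / q * Real.exp (-(n * q) / 4) ≤ n * Real.exp (-((3 : ℕ) * Real.log n)) := by
        refine mul_le_mul hinv (Real.exp_le_exp.2 ?_) (Real.exp_pos _).le hn.le
        push_cast; linarith
    _ = 1 / (n : ℝ) ^ 2 := by
        rw [exp_neg_mul_log_natCast (by omega)]; field_simp

/-! ### Pointwise dimensions as real numbers -/

section PointwiseDim

variable {d : ℕ} {P : Measure (EuclideanSpace ℝ (Fin d))} {x : EuclideanSpace ℝ (Fin d)}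
  {S : Set (EuclideanSpace ℝ (Fin d))} {r₀ δ d' : ℝ}

lemma logRatio_eq_coe {r : ℝ} (h : 0 < P.real (Metric.closedBall x r)) :
    logRatio P x r = (localExponent P x r : EReal) := by
  rw [logRatio, ENNReal.log_pos_real' h, ← EReal.coe_div]; rfl

lemma IsStandardAt.le_measureReal [IsFiniteMeasure P] (h : IsStandardAt P x r₀ δ d') {r : ℝ}
    (hr : r ∈ Ioo 0 r₀) : δ * r ^ d' ≤ P.real (Metric.closedBall x r) :=
  (ENNReal.ofReal_le_iff_le_toReal (measure_ne_top _ _)).1 (h.2.2.2 r hr)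

lemma eventually_measureReal_closedBall_pos [IsFiniteMeasure P]
    (h : ∀ x ∈ S, IsStandardAt P x r₀ δ d') :
    ∀ᶠ r in 𝓝[>] (0 : ℝ), ∀ x ∈ S, 0 < P.real (Metric.closedBall x r) := by
  rcases S.eq_empty_or_nonempty with rfl | ⟨x₀, hx₀⟩
  · simp
  filter_upwards [Ioo_mem_nhdsGT (h x₀ hx₀).1] with r hr x hx
  exact (mul_pos (h x hx).2.1 (Real.rpow_pos_of_pos hr.1 _)).trans_le ((h x hx).le_measureReal hr)

lemma tendsto_pointwiseDim (h : PointwiseDimExists P x) :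
    Tendsto (fun r : ℝ => logRatio P x r) (𝓝[>] 0) (𝓝 (pointwiseDim P x)) :=
  tendsto_nhds_limUnder h

/-- Standardness with exponent `d'` bounds the pointwise dimension by `d'`. -/
lemma pointwiseDim_mem_Icc [IsProbabilityMeasure P] (hx : PointwiseDimExists P x)
    (h : IsStandardAt P x r₀ δ d') : pointwiseDim P x ∈ Icc 0 (d' : EReal) := by
  obtain ⟨h0, hδ, -, -⟩ := id h
  have hpos : ∀ᶠ r in 𝓝[>] (0 : ℝ), r ∈ Ioo 0 r₀ ∧ r ∈ Ioo 0 1 :=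
    Filter.Eventually.and (Ioo_mem_nhdsGT h0) (Ioo_mem_nhdsGT one_pos)
  have hcomp : ∀ r : ℝ, r ∈ Ioo 0 r₀ → 0 < P.real (Metric.closedBall x r) := fun r hr =>
    (mul_pos hδ (Real.rpow_pos_of_pos hr.1 _)).trans_le (h.le_measureReal hr)
  constructor
  · refine ge_of_tendsto (tendsto_pointwiseDim hx) ?_
    filter_upwards [hpos] with r hr
    rw [logRatio_eq_coe (hcomp r hr.1), EReal.coe_nonneg]
    exact div_nonneg_of_nonpos (Real.log_nonpos measureReal_nonneg measureReal_le_one)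
      (Real.log_neg hr.2.1 hr.2.2).le
  · have hlim : Tendsto (fun r : ℝ => ((d' + Real.log δ / Real.log r : ℝ) : EReal)) (𝓝[>] 0)
        (𝓝 (d' : EReal)) := by
      refine (continuous_coe_real_ereal.tendsto d').comp ?_
      have := (Real.tendsto_log_nhdsGT_zero.const_div_atBot (Real.log δ)).const_add d'
      simpa using this
    refine le_of_tendsto_of_tendsto (tendsto_pointwiseDim hx) hlim ?_
    filter_upwards [hpos] with r hr
    rw [logRatio_eq_coe (hcomp r hr.1), EReal.coe_le_coe_iff, localExponent]
    have hl := Real.log_neg hr.2.1 hr.2.2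
    have hle : Real.log δ + d' * Real.log r ≤ Real.log (P.real (Metric.closedBall x r)) := by
      rw [← Real.log_rpow hr.1.1, ← Real.log_mul hδ.ne' (Real.rpow_pos_of_pos hr.1.1 _).ne']
      exact Real.log_le_log (mul_pos hδ (Real.rpow_pos_of_pos hr.1.1 _)) (h.le_measureReal hr.1)
    rw [div_le_iff_of_neg hl, add_mul, div_mul_cancel₀ _ hl.ne]
    linarith

lemma coe_toReal_pointwiseDim [IsProbabilityMeasure P] (hx : PointwiseDimExists P x)
    (h : IsStandardAt P x r₀ δ d') : ((pointwiseDim P x).toReal : EReal) = pointwiseDim P x := by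
  obtain ⟨h1, h2⟩ := pointwiseDim_mem_Icc hx h
  refine EReal.coe_toReal (fun ht => ?_) (fun hb => ?_)
  · rw [ht] at h2; exact absurd (top_le_iff.1 h2) (EReal.coe_ne_top _)
  · rw [hb] at h1; exact absurd (le_bot_iff.1 h1) EReal.zero_ne_bot

lemma toReal_pointwiseDim_mem_Icc [IsProbabilityMeasure P] (hx : PointwiseDimExists P x)
    (h : IsStandardAt P x r₀ δ d') : (pointwiseDim P x).toReal ∈ Icc 0 d' := by
  have h1 := pointwiseDim_mem_Icc hx h
  rw [← coe_toReal_pointwiseDim hx h] at h1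
  exact ⟨EReal.coe_nonneg.1 h1.1, EReal.coe_le_coe_iff.1 h1.2⟩

end PointwiseDim

/-! ### Limits in the extended reals -/

lemma EReal.tendsto_coe_of_forall_pos {ι : Type*} {l : Filter ι} {u : ι → EReal} {a : ℝ}
    (h : ∀ ε : ℝ, 0 < ε → ∀ᶠ n in l, ((a - ε : ℝ) : EReal) ≤ u n ∧ u n ≤ ((a + ε : ℝ) : EReal)) :
    Tendsto u l (𝓝 (a : EReal)) := by
  refine tendsto_order.2 ⟨fun b hb => ?_, fun b hb => ?_⟩
  · obtain ⟨c, hbc, hca⟩ := EReal.lt_iff_exists_real_btwn.1 hb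
    have hca' : c < a := EReal.coe_lt_coe_iff.1 hca
    filter_upwards [h (a - c) (by linarith)] with n hn
    exact hbc.trans_le (by simpa using hn.1)
  · obtain ⟨c, hac, hcb⟩ := EReal.lt_iff_exists_real_btwn.1 hb
    have hac' : a < c := EReal.coe_lt_coe_iff.1 hac
    filter_upwards [h (c - a) (by linarith)] with n hn
    exact lt_of_le_of_lt (by simpa using hn.2) hcb

section BoundedFamily

variable {ι κ : Type*} {l : Filter κ} {S : Set ι} {D : ι → ℝ} {f : κ → ι → EReal} {a : ℝ}

lemma EReal.tendsto_biSup_coe (ha : ⨆ x ∈ S, (D x : EReal) = a)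
    (h : ∀ ε : ℝ, 0 < ε → ∀ᶠ n in l, ∀ x ∈ S,
      ((D x - ε : ℝ) : EReal) ≤ f n x ∧ f n x ≤ ((D x + ε : ℝ) : EReal)) :
    Tendsto (fun n => ⨆ x ∈ S, f n x) l (𝓝 (⨆ x ∈ S, (D x : EReal))) := by
  rw [ha]
  refine EReal.tendsto_coe_of_forall_pos fun ε hε => ?_
  filter_upwards [h (ε / 2) (half_pos hε)] with n hn
  constructor
  · have hlt : ((a - ε / 2 : ℝ) : EReal) < ⨆ x ∈ S, (D x : EReal) := by
      rw [ha, EReal.coe_lt_coe_iff]; linarith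
    obtain ⟨x, hx, hlt⟩ := lt_biSup_iff.1 hlt
    refine le_trans ?_ ((hn x hx).1.trans (le_biSup (f n) hx))
    rw [EReal.coe_lt_coe_iff] at hlt
    rw [EReal.coe_le_coe_iff]; linarith
  · refine iSup₂_le fun x hx => (hn x hx).2.trans ?_
    have hle : (D x : EReal) ≤ a := ha ▸ le_biSup (fun x => (D x : EReal)) hx
    rw [EReal.coe_le_coe_iff] at hle ⊢
    linarith

lemma EReal.tendsto_biInf_coe (ha : ⨅ x ∈ S, (D x : EReal) = a)
    (h : ∀ ε : ℝ, 0 < ε → ∀ᶠ n in l, ∀ x ∈ S,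
      ((D x - ε : ℝ) : EReal) ≤ f n x ∧ f n x ≤ ((D x + ε : ℝ) : EReal)) :
    Tendsto (fun n => ⨅ x ∈ S, f n x) l (𝓝 (⨅ x ∈ S, (D x : EReal))) := by
  rw [ha]
  refine EReal.tendsto_coe_of_forall_pos fun ε hε => ?_
  filter_upwards [h (ε / 2) (half_pos hε)] with n hn
  constructor
  · refine le_iInf₂ fun x hx => le_trans ?_ (hn x hx).1
    have hle : (a : EReal) ≤ D x := ha ▸ biInf_le (fun x => (D x : EReal)) hx
    rw [EReal.coe_le_coe_iff] at hle ⊢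
    linarith
  · have hlt : ⨅ x ∈ S, (D x : EReal) < ((a + ε / 2 : ℝ) : EReal) := by
      rw [ha, EReal.coe_lt_coe_iff]; linarith
    simp only [iInf_lt_iff, exists_prop] at hlt
    obtain ⟨x, hx, hlt⟩ := hlt
    refine ((biInf_le (f n) hx).trans (hn x hx).2).trans ?_
    rw [EReal.coe_lt_coe_iff] at hlt
    rw [EReal.coe_le_coe_iff]; linarith

lemma EReal.exists_coe_eq {a b : ℝ} {y : EReal} (h1 : (a : EReal) ≤ y) (h2 : y ≤ b) :
    ∃ c : ℝ, y = c := by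
  induction y with
  | bot => exact absurd (le_bot_iff.1 h1) (EReal.coe_ne_bot a)
  | coe c => exact ⟨c, rfl⟩
  | top => exact absurd (top_le_iff.1 h2) (EReal.coe_ne_top b)

lemma EReal.exists_biSup_coe_eq {b : ℝ} (hS : S.Nonempty) (h : ∀ x ∈ S, D x ≤ b) :
    ∃ c : ℝ, ⨆ x ∈ S, (D x : EReal) = c := by
  obtain ⟨x, hx⟩ := hS
  exact EReal.exists_coe_eq (le_biSup (fun x => (D x : EReal)) hx)
    (iSup₂_le fun x hx => EReal.coe_le_coe_iff.2 (h x hx))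

lemma EReal.exists_biInf_coe_eq {b : ℝ} (hS : S.Nonempty) (h : ∀ x ∈ S, b ≤ D x) :
    ∃ c : ℝ, ⨅ x ∈ S, (D x : EReal) = c := by
  obtain ⟨x, hx⟩ := hS
  exact EReal.exists_coe_eq (le_iInf₂ fun x hx => EReal.coe_le_coe_iff.2 (h x hx))
    (biInf_le (fun x => (D x : EReal)) hx)

end BoundedFamily

/-! ### Consistency of the estimator -/

section Consistency

variable {d : ℕ} {Ω : Type*} [MeasurableSpace Ω] {μ : Measure Ω} [IsProbabilityMeasure μ]
  {P : Measure (EuclideanSpace ℝ (Fin d))} [IsProbabilityMeasure P]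
  {S : Set (EuclideanSpace ℝ (Fin d))} {X : ℕ → Ω → EuclideanSpace ℝ (Fin d)}
  {r₀ δ d' : ℝ}

/-- Uniform convergence of extended real log-ratios, restated for real local exponents. -/
lemma eventually_abs_localExponent_sub_pointwiseDim_le
    (hst : ∀ x ∈ S, IsStandardAt P x r₀ δ d') (hex : ∀ x ∈ S, PointwiseDimExists P x)
    (hunif : Tendsto (fun r : ℝ => ⨆ x ∈ S, (logRatio P x r - pointwiseDim P x).abs)
      (𝓝[>] 0) (𝓝 0)) {ε : ℝ} (hε : 0 < ε) :
    ∀ᶠ r in 𝓝[>] (0 : ℝ), ∀ x ∈ S, |localExponent P x r - (pointwiseDim P x).toReal| ≤ ε := by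
  filter_upwards [ENNReal.tendsto_nhds_zero.1 hunif (ENNReal.ofReal ε) (by simpa using hε),
    eventually_measureReal_closedBall_pos hst] with r h1 h2 x hx
  have h3 := (le_biSup (fun x => (logRatio P x r - pointwiseDim P x).abs) hx).trans h1
  rwa [logRatio_eq_coe (h2 x hx), ← coe_toReal_pointwiseDim (hex x hx) (hst x hx),
    ← EReal.coe_sub, EReal.abs_def, ENNReal.ofReal_le_ofReal_iff hε.le] at h3

/-- At a single point the balls need no net: with `C > 28 / (3 δ)` the mean number of points in the
ball is at least `28 / 3 * log n`, and Chernoff's bound is summable. -/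
lemma ae_tendsto_pointwiseDimEstimator (hX : ∀ i, Measurable (X i)) (hind : iIndepFun X μ)
    (hlaw : ∀ i, μ.map (X i) = P) {x : EuclideanSpace ℝ (Fin d)} (hex : PointwiseDimExists P x)
    (hst : IsStandardAt P x r₀ δ d') {C : ℝ} (hC : 28 / (3 * δ) < C) :
    ∀ᵐ ω ∂μ, Tendsto (fun n : ℕ => pointwiseDimEstimator X ω n (smoothingRadius C d' n) x)
      atTop (𝓝 (pointwiseDim P x)) := by
  obtain ⟨h0, hδ, hd', -⟩ := id hst
  have hC0 : 0 < C := lt_trans (by positivity) hC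
  have hδC : 28 / 3 < δ * C := by
    rw [div_lt_iff₀ (by positivity)] at hC
    linarith
  have hr := tendsto_smoothingRadius hC0 hd'
  have hbound : ∀ᶠ n : ℕ in atTop, ∀ y ∈ ({x} : Finset (EuclideanSpace ℝ (Fin d))),
      ((({x} : Finset (EuclideanSpace ℝ (Fin d))).card : ℕ) : ℝ) *
        Real.exp (-(n * P.real (Metric.closedBall y (smoothingRadius C d' n))) / 4)
        ≤ 1 / (n : ℝ) ^ 2 := by
    filter_upwards [hr.eventually (Ioo_mem_nhdsGT h0), eventually_gt_atTop 0] with n h1 h2 y hy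
    rw [Finset.mem_singleton.1 hy, Finset.card_singleton, Nat.cast_one, one_mul,
      ← exp_neg_mul_log_natCast h2, Real.exp_le_exp]
    have hn : (0 : ℝ) < n := by exact_mod_cast h2
    have hmass := hst.le_measureReal h1
    rw [smoothingRadius_rpow hC0 hd'] at hmass
    have hmean : δ * C * Real.log n
        ≤ n * P.real (Metric.closedBall x (smoothingRadius C d' n)) := by
      calc δ * C * Real.log n = n * (δ * (C * (Real.log n / n))) := by field_simp
        _ ≤ _ := by gcongr
    have hlog : 0 ≤ Real.log n := Real.log_natCast_nonneg n
    push_cast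
    nlinarith
  have hst' : ∀ y ∈ ({x} : Set (EuclideanSpace ℝ (Fin d))), IsStandardAt P y r₀ δ d' := by
    simpa using hst
  have hpos := eventually_measureReal_closedBall_pos hst'
  have hP : ∀ ε > 0, ∀ᶠ s in 𝓝[>] (0 : ℝ), ∀ y ∈ ({x} : Set (EuclideanSpace ℝ (Fin d))),
      |localExponent P y s - (pointwiseDim P y).toReal| ≤ ε := by
    have hlim : Tendsto (fun s => localExponent P x s) (𝓝[>] 0) (𝓝 (pointwiseDim P x).toReal) := by
      rw [← EReal.tendsto_coe, coe_toReal_pointwiseDim hex hst]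
      refine (tendsto_pointwiseDim hex).congr' ?_
      filter_upwards [hpos] with s hs using logRatio_eq_coe (hs x rfl)
    intro ε hε
    filter_upwards [hlim.eventually (Metric.closedBall_mem_nhds _ hε)] with s hs y hy
    rw [hy]
    exact hs
  filter_upwards [ae_eventually_empiricalMeasure_closedBall hX hind hlaw _ _ hbound] with ω hω
  rw [← coe_toReal_pointwiseDim hex hst]
  refine EReal.tendsto_coe_of_forall_pos fun ε hε => ?_
  have hcmp : ∀ᶠ n : ℕ in atTop, ∀ y ∈ ({x} : Set (EuclideanSpace ℝ (Fin d))),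
      P.real (Metric.closedBall y (smoothingRadius C d' n / 4)) / 4
        ≤ (empiricalMeasure (fun i => X i ω) n).real
          (Metric.closedBall y (smoothingRadius C d' n)) ∧
      (empiricalMeasure (fun i => X i ω) n).real (Metric.closedBall y (smoothingRadius C d' n))
        ≤ 4 * P.real (Metric.closedBall y (4 * smoothingRadius C d' n)) := by
    filter_upwards [hω, eventually_smoothingRadius_pos (a := d') hC0] with n hn hn0 y hy
    obtain ⟨h1, h2⟩ := hn y (Finset.mem_singleton.2 hy)
    have i₁ := measureReal_closedBall_mono (Q := P) (x := y) (y := y)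
      (r := smoothingRadius C d' n / 4) (s := smoothingRadius C d' n) (by rw [dist_self]; linarith)
    have i₂ := measureReal_closedBall_mono (Q := P) (x := y) (y := y)
      (r := smoothingRadius C d' n) (s := 4 * smoothingRadius C d' n) (by rw [dist_self]; linarith)
    exact ⟨by linarith, by linarith⟩
  filter_upwards [eventually_abs_localExponent_sub_le (M := (pointwiseDim P x).toReal)
    (by simp) _ hr hpos hP hcmp hε] with n hn
  obtain ⟨h1, h2⟩ := hn x rfl
  rw [pointwiseDimEstimator, logRatio_eq_coe h1, EReal.coe_le_coe_iff, EReal.coe_le_coe_iff]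
  rw [abs_le] at h2
  exact ⟨by linarith, by linarith⟩

/-- Uniform consistency in real form. The empirical masses are eventually positive, so the real
local exponents are the extended real log-ratios. -/
lemma ae_eventually_localExponent_empiricalMeasure (hX : ∀ i, Measurable (X i))
    (hind : iIndepFun X μ) (hlaw : ∀ i, μ.map (X i) = P) (hδ : 0 < δ) (hr₀ : 0 < r₀)
    (hd' : 0 < d') (hst : ∀ x ∈ S, IsStandardAt P x r₀ δ d') {D : EuclideanSpace ℝ (Fin d) → ℝ}
    (hD : ∀ x ∈ S, D x ≤ d')
    (hP : ∀ ε > 0, ∀ᶠ s in 𝓝[>] (0 : ℝ), ∀ x ∈ S, |localExponent P x s - D x| ≤ ε)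
    {β : ℝ} (hβ : 0 < β) :
    ∀ᵐ ω ∂μ, ∀ ε > 0, ∀ᶠ n : ℕ in atTop, ∀ x ∈ S,
      0 < (empiricalMeasure (fun i => X i ω) n).real
        (Metric.closedBall x (smoothingRadius β (2 * d') n)) ∧
      |localExponent (empiricalMeasure (fun i => X i ω) n) x (smoothingRadius β (2 * d') n) - D x|
        ≤ ε := by
  have h2d : 0 < 2 * d' := by linarith
  have hr := tendsto_smoothingRadius hβ h2d
  have hrpos := eventually_smoothingRadius_pos (a := 2 * d') hβ
  have hc : 0 < δ / 8 ^ d' := by positivity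
  have hmass : ∀ᶠ n : ℕ in atTop, ∀ x ∈ S,
      δ / 8 ^ d' * smoothingRadius β (2 * d') n ^ d'
        ≤ P.real (Metric.closedBall x (smoothingRadius β (2 * d') n / 8)) := by
    filter_upwards [hr.eventually (Ioo_mem_nhdsGT hr₀)] with n hn x hx
    have h8 : smoothingRadius β (2 * d') n / 8 ∈ Ioo 0 r₀ :=
      ⟨by linarith [hn.1], by linarith [hn.1, hn.2]⟩
    refine le_trans (le_of_eq ?_) ((hst x hx).le_measureReal h8)
    rw [Real.div_rpow hn.1.le (by norm_num)]
    ring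
  filter_upwards [ae_eventually_empiricalMeasure_closedBall_uniform hX hind hlaw hrpos
    (hrpos.mono fun n hn => mul_pos hc (Real.rpow_pos_of_pos hn d')) hmass
    (eventually_union_bound_smoothingRadius hc hβ hd')] with ω hω ε hε
  exact eventually_abs_localExponent_sub_le hD _ hr
    (eventually_measureReal_closedBall_pos hst) hP hω hε

end Consistency

theorem theorem4 {d : ℕ} {Ω : Type*} [MeasurableSpace Ω] (μ : Measure Ω) [IsProbabilityMeasure μ]
    (P : Measure (EuclideanSpace ℝ (Fin d))) [IsProbabilityMeasure P]
    (S : Set (EuclideanSpace ℝ (Fin d))) (hS : IsCompact S) (hPS : P.support = S)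
    (X : ℕ → Ω → EuclideanSpace ℝ (Fin d)) (hX_meas : ∀ i, Measurable (X i))
    (hX_indep : iIndepFun X μ) (hX_law : ∀ i, μ.map (X i) = P) :
    -- (a) pointwise almost sure consistency
    (∀ x ∈ S, ∀ r₀ δ d' C : ℝ, PointwiseDimExists P x → IsStandardAt P x r₀ δ d' →
      28 / (3 * δ) < C →
      ∀ᵐ ω ∂μ, Tendsto (fun n : ℕ => pointwiseDimEstimator X ω n (smoothingRadius C d' n) x)
        atTop (𝓝 (pointwiseDim P x))) ∧
    -- (b) uniform almost sure consistency and its consequences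
    (∀ r₀ δ d' β : ℝ, (∀ x ∈ S, IsStandardAt P x r₀ δ d') → (∀ x ∈ S, PointwiseDimExists P x) →
      (4 * (d : ℝ) + 12) / δ ^ 2 < β →
      Tendsto (fun r : ℝ => ⨆ x ∈ S, (logRatio P x r - pointwiseDim P x).abs) (𝓝[>] 0) (𝓝 0) →
      (∀ᵐ ω ∂μ, Tendsto (fun n : ℕ => ⨆ x ∈ S,
          (pointwiseDimEstimator X ω n (smoothingRadius β (2 * d') n) x
            - pointwiseDim P x).abs) atTop (𝓝 0)) ∧
      (∀ᵐ ω ∂μ, Tendsto (fun n : ℕ => ⨆ x ∈ S,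
          pointwiseDimEstimator X ω n (smoothingRadius β (2 * d') n) x)
        atTop (𝓝 (⨆ x ∈ S, pointwiseDim P x))) ∧
      (∀ᵐ ω ∂μ, Tendsto (fun n : ℕ => ⨅ x ∈ S,
          pointwiseDimEstimator X ω n (smoothingRadius β (2 * d') n) x)
        atTop (𝓝 (⨅ x ∈ S, pointwiseDim P x))) ∧
      ((dimH S : EReal) ≤ ⨆ x ∈ S, pointwiseDim P x) ∧
      ((⨅ x ∈ S, pointwiseDim P x) ≤ (dimH S : EReal))) := by
  refine ⟨fun x _ r₀ δ d' C hex hst hC =>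
    ae_tendsto_pointwiseDimEstimator hX_meas hX_indep hX_law hex hst hC, ?_⟩
  intro r₀ δ d' β hst hex hβ hunif
  have hne : S.Nonempty := hPS ▸ Measure.nonempty_support (IsProbabilityMeasure.ne_zero P)
  have hSc : P Sᶜ = 0 := hPS ▸ Measure.measure_compl_support
  obtain ⟨x₀, hx₀⟩ := id hne
  obtain ⟨hr₀, hδ, hd', -⟩ := hst x₀ hx₀
  have hβ0 : 0 < β := lt_trans (by positivity) hβ
  obtain ⟨D, hD⟩ : ∃ D : EuclideanSpace ℝ (Fin d) → ℝ, ∀ x, (pointwiseDim P x).toReal = D x :=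
    ⟨_, fun _ => rfl⟩
  have hDcoe : ∀ x ∈ S, pointwiseDim P x = (D x : EReal) := fun x hx =>
    hD x ▸ (coe_toReal_pointwiseDim (hex x hx) (hst x hx)).symm
  have hDmem : ∀ x ∈ S, D x ∈ Icc 0 d' := fun x hx =>
    hD x ▸ toReal_pointwiseDim_mem_Icc (hex x hx) (hst x hx)
  have hpos := eventually_measureReal_closedBall_pos hst
  have hP : ∀ ε > 0, ∀ᶠ s in 𝓝[>] (0 : ℝ), ∀ x ∈ S, |localExponent P x s - D x| ≤ ε := by
    intro ε hε
    simpa only [hD] using eventually_abs_localExponent_sub_pointwiseDim_le hst hex hunif hε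
  obtain ⟨M, hM⟩ := EReal.exists_biSup_coe_eq hne fun x hx => (hDmem x hx).2
  obtain ⟨m, hm⟩ := EReal.exists_biInf_coe_eq hne fun x hx => (hDmem x hx).1
  have hDM : ∀ x ∈ S, D x ≤ M := fun x hx =>
    EReal.coe_le_coe_iff.1 (hM ▸ le_biSup (fun x => (D x : EReal)) hx)
  have hDm : ∀ x ∈ S, m ≤ D x := fun x hx =>
    EReal.coe_le_coe_iff.1 (hm ▸ biInf_le (fun x => (D x : EReal)) hx)
  have hae := ae_eventually_localExponent_empiricalMeasure hX_meas hX_indep hX_law hδ hr₀ hd' hst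
    (fun x hx => (hDmem x hx).2) hP hβ0
  have hbounds : ∀ᵐ ω ∂μ, ∀ ε : ℝ, 0 < ε → ∀ᶠ n : ℕ in atTop, ∀ x ∈ S,
      ((D x - ε : ℝ) : EReal) ≤ pointwiseDimEstimator X ω n (smoothingRadius β (2 * d') n) x ∧
      pointwiseDimEstimator X ω n (smoothingRadius β (2 * d') n) x ≤ ((D x + ε : ℝ) : EReal) := by
    filter_upwards [hae] with ω hω ε hε
    filter_upwards [hω ε hε] with n hn x hx
    obtain ⟨h1, h2⟩ := hn x hx
    rw [pointwiseDimEstimator, logRatio_eq_coe h1, EReal.coe_le_coe_iff, EReal.coe_le_coe_iff]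
    rw [abs_le] at h2
    exact ⟨by linarith, by linarith⟩
  rw [biSup_congr hDcoe, biInf_congr hDcoe]
  refine ⟨?_, ?_, ?_, ?_, ?_⟩
  · filter_upwards [hae] with ω hω
    refine ENNReal.tendsto_nhds_zero.2 fun η hη => ?_
    obtain ⟨ε, hε, hεη⟩ := ENNReal.lt_iff_exists_nnreal_btwn.1 hη
    filter_upwards [hω ε (by exact_mod_cast hε)] with n hn
    refine iSup₂_le fun x hx => le_trans ?_ hεη.le
    obtain ⟨h1, h2⟩ := hn x hx
    rw [hDcoe x hx, pointwiseDimEstimator, logRatio_eq_coe h1, ← EReal.coe_sub, EReal.abs_def,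
      ← ENNReal.ofReal_coe_nnreal]
    exact ENNReal.ofReal_le_ofReal h2
  · filter_upwards [hbounds] with ω hω
    exact EReal.tendsto_biSup_coe hM hω
  · filter_upwards [hbounds] with ω hω
    exact EReal.tendsto_biInf_coe hm hω
  · have hM0 : 0 ≤ M := (hDmem x₀ hx₀).1.trans (hDM x₀ hx₀)
    have h := dimH_le_of_localExponent hM0 hDM hpos hP
    have h' := EReal.coe_ennreal_le_coe_ennreal_iff.2 h
    rwa [EReal.coe_ennreal_ofReal, max_eq_left hM0, ← hM] at h'
  · have h := le_dimH_of_localExponent hDm hSc hpos hP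
    rw [hm]
    refine le_trans ?_ (EReal.coe_ennreal_le_coe_ennreal_iff.2 h)
    rw [EReal.coe_ennreal_ofReal]
    exact EReal.coe_le_coe_iff.2 (le_max_left m 0)
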